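/- Let $n\ge 2$, $0<\lambda\le\Lambda$, $p,q>0$, and put $\tilde n=\frac{\lambda}{\Lambda}(n-1)+1$. Let $\mathbb R^n_+=\{x\in\mathbb R^n: x_n>0\}$, and for a real symmetric $n\times n$ matrix $M$ with eigenvalues $e_1,\dots,e_n$ let $$\mathcal M^+_{\lambda,\Lambda}(M)=\Lambda\sum_{e_i>0}e_i+\lambda\sum_{e_i<0}e_i .$$ A nonnegative viscosity supersolution of the system $$\mathcal M^+_{\lambda,\Lambda}(D^2u)+v^p=0,\qquad \mathcal M^+_{\lambda,\Lambda}(D^2v)+u^q=0\qquad\text{in }\mathbb R^n_+$$ is a pair of continuous functions $u,v:\mathbb R^n_+\to[0,\infty)$ (no boundary condition is imposed) such that, for all $x_0\in\mathbb R^n_+$ and $\varphi\in C^2(\mathbb R^n_+)$, if $u-\varphi$ has a local minimum at $x_0$ then $\mathcal M^+_{\lambda,\Lambda}(D^2\varphi(x_0))+v(x_0)^p\le 0$, and if $v-\varphi$ has a local minimum at $x_0$ then $\mathcal M^+_{\lambda,\Lambda}(D^2\varphi(x_0))+u(x_0)^q\le 0$. It is nontrivial if $u$ and $v$ are not both identically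 zero. Assume that $\tilde n\ge 2$ and that one of the following holds: 1. $pq>1$, and $\frac{2(p+1)}{pq-1}>\tilde n-1$ or $\frac{2(q+1)}{pq-1}>\tilde n-1$; 2. $\frac{2(p+1)}{pq-1}=\tilde n-1$ and $\frac{2(q+1)}{pq-1}=\tilde n-1$; 3. $pq=1$. Then the system has no nontrivial nonnegative viscosity supersolution. -/

import Mathlib

/-- The open half space `{x ∈ ℝⁿ : x_n > 0}`, where `x_n` is the last coordinate. -/
def halfSpace (n : ℕ) : Set (EuclideanSpace ℝ (Fin n)) :=
  {x | ∃ i : Fin n, (i : ℕ) + 1 = n ∧ 0 < x i}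

/-- The Hessian matrix `D²φ(x)` with entries `∂ᵢ∂ⱼφ(x)`. -/
noncomputable def hessian {n : ℕ} (φ : EuclideanSpace ℝ (Fin n) → ℝ)
    (x : EuclideanSpace ℝ (Fin n)) : Matrix (Fin n) (Fin n) ℝ :=
  Matrix.of fun i j =>
    fderiv ℝ (fderiv ℝ φ) x (EuclideanSpace.single i 1) (EuclideanSpace.single j 1)

open Classical in
/-- The Pucci maximal operator with parameters `l ≤ L`: for a real symmetric matrix `M` with
eigenvalues `e₁, …, eₙ` (with multiplicity) it is `L ∑_{eᵢ > 0} eᵢ + l ∑_{eᵢ < 0} eᵢ`.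
It is only ever applied to symmetric matrices, see `hessian_isHermitian`. -/
noncomputable def pucciPlus {n : ℕ} (l L : ℝ) (M : Matrix (Fin n) (Fin n) ℝ) : ℝ :=
  if hM : M.IsHermitian then
    L * (∑ i with 0 < hM.eigenvalues i, hM.eigenvalues i) +
      l * (∑ i with hM.eigenvalues i < 0, hM.eigenvalues i)
  else 0

/-- `u` is a viscosity supersolution of `F(x, D²u) = 0` in the open set `Ω`. -/
def IsViscositySupersolution {n : ℕ}
    (F : EuclideanSpace ℝ (Fin n) → Matrix (Fin n) (Fin n) ℝ → ℝ)
    (Ω : Set (EuclideanSpace ℝ (Fin n))) (u : EuclideanSpace ℝ (Fin n) → ℝ) : Prop :=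
  ContinuousOn u Ω ∧
    ∀ x₀ ∈ Ω, ∀ φ : EuclideanSpace ℝ (Fin n) → ℝ, ContDiffOn ℝ 2 φ Ω →
      IsLocalMinOn (fun x => u x - φ x) Ω x₀ → F x₀ (hessian φ x₀) ≤ 0

/-- `(u, v)` is a nonnegative viscosity supersolution of the system
`M⁺(D²u) + v^p = 0`, `M⁺(D²v) + u^q = 0` in the open half space (no boundary condition). -/
structure IsNonnegSystemSupersolution (n : ℕ) (l L p q : ℝ)
    (u v : EuclideanSpace ℝ (Fin n) → ℝ) : Prop where
  nonneg_left : ∀ x ∈ halfSpace n, 0 ≤ u x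
  nonneg_right : ∀ x ∈ halfSpace n, 0 ≤ v x
  left : IsViscositySupersolution (fun x M => pucciPlus l L M + v x ^ p) (halfSpace n) u
  right : IsViscositySupersolution (fun x M => pucciPlus l L M + u x ^ q) (halfSpace n) v

/-- The dimension-like number `ñ = (l / L) (n - 1) + 1`. -/
noncomputable def dimTilde (n : ℕ) (l L : ℝ) : ℝ := l / L * ((n : ℝ) - 1) + 1

/-- The Hessian of a `C²` function on an open set is symmetric, so that the first branch of
`pucciPlus` is the one used for test functions. -/
theorem hessian_isHermitian {n : ℕ} {Ω : Set (EuclideanSpace ℝ (Fin n))} (hΩ : IsOpen Ω)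
    {φ : EuclideanSpace ℝ (Fin n) → ℝ} (hφ : ContDiffOn ℝ 2 φ Ω)
    {x : EuclideanSpace ℝ (Fin n)} (hx : x ∈ Ω) : (hessian φ x).IsHermitian := by
  have h : ContDiffAt ℝ 2 φ x := hφ.contDiffAt (hΩ.mem_nhds hx)
  have hs : IsSymmSndFDerivAt ℝ φ x := h.isSymmSndFDerivAt (by simp)
  ext i j
  simpa [hessian] using hs _ _

theorem isOpen_halfSpace (n : ℕ) : IsOpen (halfSpace n) := by
  have : halfSpace n = ⋃ i : Fin n, ⋃ _ : (i : ℕ) + 1 = n,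
      {x : EuclideanSpace ℝ (Fin n) | 0 < x i} := by
    ext x; simp [halfSpace]
  rw [this]
  refine isOpen_iUnion fun i => isOpen_iUnion fun _ => ?_
  exact isOpen_lt continuous_const (by fun_prop)

open Filter Topology

/-! Nonexistence comes from a clash between two bounds at distance `r` from a base point, at height
comparable to `r`. The operator is only ever used through linear minorants `tr((a I + b z zᵀ) D²φ)`,
with `a`, `b`, `z` free to vary from point to point (`le_pucciPlus`); touching a supersolution by a
strict subsolution of such a minorant is impossible.

Upper bound: comparison on balls gives `min u ≥ κ r² (min v)^p`, and the same with `u`, `v` and `p`,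
`q` exchanged. Composing the two bounds `(κ r²)^(1+p) (min u)^(pq-1)` by `1` (`exists_rpow_le`). For
`pq = 1` this already fails for large `r`; for `pq > 1` it forces decay of order
`r^(-2(p+1)/(pq-1))`.

Lower bound: put weight `L` on the radial direction and `l` on the others. On functions `t
F(|x-c|²)`, with `t = x_n - c_n`, this minorant is `L` times the Laplacian of dimension `N = ñ`, so
it kills `t |x-c|^(-N)`. Hence `u ≥ η t |x-c|^(-N)` (`exists_singular_le`), of order `r^(1-N)` where
`t` is comparable to `r`, which settles the subcritical case.

In the critical case `p = q` and the powers of `r` balance. Inserting the bound for `v` into the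
equation for `u` gains a factor `log r` (`exists_log_le`), which breaks the balance. -/

/-! ### Linear minorants of the Pucci operator and test functions -/

/-- The Pucci maximal operator dominates every trace `tr(A M)` with `A = a I + b z zᵀ` and
`l ≤ A ≤ L`. -/
theorem le_pucciPlus {n : ℕ} {l L a b : ℝ} {M : Matrix (Fin n) (Fin n) ℝ} (hM : M.IsHermitian)
    (z : EuclideanSpace ℝ (Fin n)) (ha : l ≤ a) (hb : 0 ≤ b) (hab : a + b * ‖z‖ ^ 2 ≤ L) :
    a * M.trace + b * ∑ i, ∑ j, z i * z j * M i j ≤ pucciPlus l L M := by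
  classical
  have hquad : ∑ i, ∑ j, z i * z j * M i j =
      ∑ i, hM.eigenvalues i * inner ℝ (hM.eigenvectorBasis i) z ^ 2 := by
    have h1 : ∑ i, ∑ j, z i * z j * M i j = inner ℝ z (Matrix.toEuclideanLin M z) := by
      simp only [PiLp.inner_apply, Matrix.toLpLin_apply, Matrix.mulVec, dotProduct]
      refine Finset.sum_congr rfl fun i _ => ?_
      simp only [RCLike.inner_apply, conj_trivial, Finset.sum_mul]
      exact Finset.sum_congr rfl fun j _ => by ring
    rw [h1, ← hM.eigenvectorBasis.sum_inner_mul_inner]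
    refine Finset.sum_congr rfl fun i _ => ?_
    have hs : (Matrix.toEuclideanLin M).IsSymmetric := Matrix.isSymmetric_toEuclideanLin_iff.2 hM
    have he : Matrix.toEuclideanLin M (hM.eigenvectorBasis i)
        = hM.eigenvalues i • hM.eigenvectorBasis i := by
      ext j
      have := congrFun (hM.mulVec_eigenvectorBasis i) j
      simpa [Matrix.toLpLin_apply] using this
    rw [← hs, he, inner_smul_left, real_inner_comm]
    simp; ring
  have htr : M.trace = ∑ i, hM.eigenvalues i := by
    simpa using hM.trace_eq_sum_eigenvalues
  rw [hquad, htr, pucciPlus, dif_pos hM, Finset.mul_sum, Finset.mul_sum, Finset.mul_sum,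
    Finset.mul_sum, ← Finset.sum_add_distrib, Finset.sum_filter, Finset.sum_filter,
    ← Finset.sum_add_distrib]
  -- In an eigenbasis of `M` the trace is a sum of eigenvalues with weights `a + b ⟪vᵢ, z⟫²`, which
  -- Cauchy–Schwarz keeps in `[l, L]`; compare term by term according to sign.
  refine Finset.sum_le_sum fun i _ => ?_
  have hc0 : 0 ≤ inner ℝ (hM.eigenvectorBasis i) z ^ 2 := sq_nonneg _
  have hc1 : inner ℝ (hM.eigenvectorBasis i) z ^ 2 ≤ ‖z‖ ^ 2 := by
    have := abs_real_inner_le_norm (hM.eigenvectorBasis i) z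
    rw [hM.eigenvectorBasis.orthonormal.1 i, one_mul] at this
    rw [← sq_abs]; gcongr
  set e := hM.eigenvalues i
  set c := inner ℝ (hM.eigenvectorBasis i) z ^ 2
  have h1 : l ≤ a + b * c := by nlinarith [mul_nonneg hb hc0]
  have h2 : a + b * c ≤ L := by nlinarith [mul_le_mul_of_nonneg_left hc1 hb]
  rcases lt_trichotomy e 0 with h | h | h
  · rw [if_neg h.not_gt, if_pos h]; nlinarith
  · simp [h]
  · rw [if_pos h, if_neg h.not_gt]; nlinarith

/-- The linear second order operator `tr((a I + b z zᵀ) D²φ(x))`. -/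
noncomputable def linearOp {n : ℕ} (a b : ℝ) (z : EuclideanSpace ℝ (Fin n))
    (φ : EuclideanSpace ℝ (Fin n) → ℝ) (x : EuclideanSpace ℝ (Fin n)) : ℝ :=
  a * (hessian φ x).trace + b * ∑ i, ∑ j, z i * z j * hessian φ x i j

theorem linearOp_add {n : ℕ} (a b : ℝ) (z : EuclideanSpace ℝ (Fin n))
    {φ ψ : EuclideanSpace ℝ (Fin n) → ℝ} {x : EuclideanSpace ℝ (Fin n)}
    (hφ : ContDiffAt ℝ 2 φ x) (hψ : ContDiffAt ℝ 2 ψ x) :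
    linearOp a b z (fun y => φ y + ψ y) x = linearOp a b z φ x + linearOp a b z ψ x := by
  have key : hessian (fun y => φ y + ψ y) x = hessian φ x + hessian ψ x := by
    have h1 : fderiv ℝ (fun y => φ y + ψ y) =ᶠ[𝓝 x] fun y => fderiv ℝ φ y + fderiv ℝ ψ y := by
      filter_upwards [hφ.eventually (by simp), hψ.eventually (by simp)] with y h1 h2
      exact fderiv_fun_add (h1.differentiableAt (by simp)) (h2.differentiableAt (by simp))
    have d1 : DifferentiableAt ℝ (fderiv ℝ φ) x :=
      (hφ.fderiv_right (m := 1) (by norm_num)).differentiableAt (by simp)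
    have d2 : DifferentiableAt ℝ (fderiv ℝ ψ) x :=
      (hψ.fderiv_right (m := 1) (by norm_num)).differentiableAt (by simp)
    ext i j
    simp [hessian, h1.fderiv_eq, fderiv_fun_add d1 d2]
  simp only [linearOp, key, Matrix.trace_add, Matrix.add_apply, mul_add, Finset.sum_add_distrib]
  ring

/-- Test functions need to be `C²` near the touching point only. -/
theorem IsViscositySupersolution.le_of_contDiffAt {n : ℕ}
    {F : EuclideanSpace ℝ (Fin n) → Matrix (Fin n) (Fin n) ℝ → ℝ}
    {Ω : Set (EuclideanSpace ℝ (Fin n))} {u : EuclideanSpace ℝ (Fin n) → ℝ}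
    (hu : IsViscositySupersolution F Ω u) {x : EuclideanSpace ℝ (Fin n)}
    (hx : x ∈ Ω) {φ : EuclideanSpace ℝ (Fin n) → ℝ} (hφ : ContDiffAt ℝ 2 φ x)
    (hmin : IsLocalMin (fun y => u y - φ y) x) : F x (hessian φ x) ≤ 0 := by
  obtain ⟨δ, hδ, hball⟩ := Metric.eventually_nhds_iff_ball.1 (hφ.eventually (by simp))
  -- A cutoff makes `φ` globally `C²` without changing it near `x`. This is needed because the later
  -- barriers are singular at a point `c` inside the half space.
  let χ : ContDiffBump x := ⟨δ / 4, δ / 2, by positivity, by linarith⟩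
  have hχ : (fun y => χ y * φ y) =ᶠ[𝓝 x] φ := by
    filter_upwards [χ.eventuallyEq_one] with y hy
    simp [hy]
  have hc : ContDiff ℝ 2 fun y => χ y * φ y := by
    rw [contDiff_iff_contDiffAt]
    intro y
    by_cases hy : y ∈ Metric.ball x δ
    · exact (χ.contDiff.contDiffAt).mul (hball y hy)
    · have h0 : (fun y => χ y * φ y) =ᶠ[𝓝 y] fun _ => 0 := by
        have hy' : y ∈ (Metric.closedBall x (δ / 2))ᶜ := by
          intro h
          exact hy (Metric.closedBall_subset_ball (by linarith) h)
        filter_upwards [Metric.isClosed_closedBall.isOpen_compl.mem_nhds hy'] with w hw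
        have : χ w = 0 := χ.zero_of_le_dist (by
          have : ¬ dist w x ≤ δ / 2 := hw
          exact (not_le.1 this).le)
        simp [this]
      exact contDiffAt_const.congr_of_eventuallyEq h0
  have hh : hessian (fun y => χ y * φ y) x = hessian φ x := by
    ext i j
    simp [hessian, hχ.fderiv.fderiv_eq]
  rw [← hh]
  refine hu.2 x hx _ hc.contDiffOn ?_
  refine IsLocalMin.on (hmin.congr ?_) Ω
  filter_upwards [hχ] with y hy
  rw [hy]

/-- A supersolution of `M⁺(D²u) + f ≤ 0` cannot be touched from below by a strict subsolution of
one of the linear operators below `M⁺`. -/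
theorem IsViscositySupersolution.linearOp_add_le {n : ℕ} {l L : ℝ}
    {f : EuclideanSpace ℝ (Fin n) → ℝ}
    {Ω : Set (EuclideanSpace ℝ (Fin n))} {u : EuclideanSpace ℝ (Fin n) → ℝ}
    (hu : IsViscositySupersolution (fun x M => pucciPlus l L M + f x) Ω u)
    {x : EuclideanSpace ℝ (Fin n)} (hx : x ∈ Ω)
    {φ : EuclideanSpace ℝ (Fin n) → ℝ} (hφ : ContDiffAt ℝ 2 φ x)
    (hmin : IsLocalMin (fun y => u y - φ y) x) {a b : ℝ} (z : EuclideanSpace ℝ (Fin n))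
    (ha : l ≤ a) (hb : 0 ≤ b) (hab : a + b * ‖z‖ ^ 2 ≤ L) :
    linearOp a b z φ x + f x ≤ 0 := by
  have hH : (hessian φ x).IsHermitian := by
    ext i j
    simpa [hessian] using hφ.isSymmSndFDerivAt (by simp) _ _
  have h1 := hu.le_of_contDiffAt hx hφ hmin
  have h2 := le_pucciPlus hH z ha hb hab
  simp only [linearOp]
  linarith

/-! ### Second derivatives of the barriers -/

theorem contDiffAt_monomial_mul_radial {n : ℕ} (i : Fin n) (k : ℕ)
    (c x : EuclideanSpace ℝ (Fin n)) {F : ℝ → ℝ} (hF : ContDiffAt ℝ 2 F (‖x - c‖ ^ 2)) :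
    ContDiffAt ℝ 2 (fun y => (y i - c i) ^ k * F (‖y - c‖ ^ 2)) x := by
  have h1 : ContDiffAt ℝ 2 (fun y : EuclideanSpace ℝ (Fin n) => (y i - c i) ^ k) x := by fun_prop
  have h2 : ContDiffAt ℝ 2 (fun y : EuclideanSpace ℝ (Fin n) => ‖y - c‖ ^ 2) x :=
    (contDiffAt_id.sub contDiffAt_const).norm_sq ℝ
  exact h1.mul (hF.comp x h2)

/-- One formula serves every barrier: `k = 0` for the exponentials, `k = 1` for the singular
solution and its logarithmic variant, `k = 3` for the correction. The truncated exponent `k - 1 - 1`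
is harmless, since its coefficient vanishes for `k ≤ 1`. -/
theorem fderiv_fderiv_monomial_mul_radial {n : ℕ} (i : Fin n) (k : ℕ)
    (c x : EuclideanSpace ℝ (Fin n)) {F F₁ : ℝ → ℝ} {F₂ : ℝ}
    (hF : ∀ᶠ s in 𝓝 (‖x - c‖ ^ 2), HasDerivAt F (F₁ s) s)
    (hF₁ : HasDerivAt F₁ F₂ (‖x - c‖ ^ 2)) (v w : EuclideanSpace ℝ (Fin n)) :
    fderiv ℝ (fderiv ℝ fun y => (y i - c i) ^ k * F (‖y - c‖ ^ 2)) x v w =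
      k * ((k - 1 : ℕ) * (x i - c i) ^ (k - 1 - 1)) * F (‖x - c‖ ^ 2) * (v i * w i) +
      k * (x i - c i) ^ (k - 1) * F₁ (‖x - c‖ ^ 2) *
        (2 * inner ℝ (x - c) v * w i + 2 * inner ℝ (x - c) w * v i) +
      (x i - c i) ^ k * (4 * F₂ * inner ℝ (x - c) v * inner ℝ (x - c) w +
        2 * F₁ (‖x - c‖ ^ 2) * inner ℝ v w) := by
  let p : EuclideanSpace ℝ (Fin n) →L[ℝ] ℝ := EuclideanSpace.proj i
  obtain ⟨J, hJ⟩ : ∃ J : EuclideanSpace ℝ (Fin n) →L[ℝ] EuclideanSpace ℝ (Fin n) →L[ℝ] ℝ,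
      ∀ v, J v = innerSL ℝ v := ⟨innerSL ℝ, fun _ => rfl⟩
  have hp (y : EuclideanSpace ℝ (Fin n)) : HasFDerivAt (fun y => y i - c i) p y :=
    p.hasFDerivAt.sub_const _
  have hpk (m : ℕ) (y : EuclideanSpace ℝ (Fin n)) :
      HasFDerivAt (fun y => (y i - c i) ^ m) ((m * (y i - c i) ^ (m - 1)) • p) y := by
    have := (hasDerivAt_pow m (y i - c i)).comp_hasFDerivAt y (hp y)
    exact this
  have hs (y : EuclideanSpace ℝ (Fin n)) :
      HasFDerivAt (fun y => ‖y - c‖ ^ 2) (2 • (J (y - c))) y := by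
    have := ((hasFDerivAt_id y).sub_const c).norm_sq
    rw [hJ]; simpa using this
  have hcont : ContinuousAt (fun y : EuclideanSpace ℝ (Fin n) => ‖y - c‖ ^ 2) x := by fun_prop
  have h1 : fderiv ℝ (fun y => (y i - c i) ^ k * F (‖y - c‖ ^ 2)) =ᶠ[𝓝 x] fun y =>
      (y i - c i) ^ k • (F₁ (‖y - c‖ ^ 2) • ((2 : ℕ) • J (y - c))) +
        F (‖y - c‖ ^ 2) • ((k * (y i - c i) ^ (k - 1)) • p) := by
    filter_upwards [hcont.eventually hF] with y hy
    exact ((hpk k y).mul (hy.comp_hasFDerivAt y (hs y))).fderiv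
  have hI : HasFDerivAt (fun y : EuclideanSpace ℝ (Fin n) => (2 : ℕ) • J (y - c))
      ((2 : ℕ) • J) x := by
    have := (J.hasFDerivAt.comp x
      ((hasFDerivAt_id x).sub_const c)).const_smul (2 : ℕ)
    exact this
  have h2 : HasFDerivAt (fun y =>
      (y i - c i) ^ k • (F₁ (‖y - c‖ ^ 2) • ((2 : ℕ) • J (y - c))) +
        F (‖y - c‖ ^ 2) • ((k * (y i - c i) ^ (k - 1)) • p)) _ x :=
    ((hpk k x).smul ((hF₁.comp_hasFDerivAt x (hs x)).smul hI)).add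
      ((hF.self_of_nhds.comp_hasFDerivAt x (hs x)).smul
        (((hpk (k - 1) x).const_mul (k : ℝ)).smul_const p))
  rw [h1.fderiv_eq, h2.fderiv]
  simp [p, hJ, inner_sub_left]
  ring

theorem sum_mul_apply_single {n : ℕ}
    (B : EuclideanSpace ℝ (Fin n) →L[ℝ] EuclideanSpace ℝ (Fin n) →L[ℝ] ℝ)
    (z : EuclideanSpace ℝ (Fin n)) :
    B z z = ∑ i, ∑ j, z i * z j *
      B (EuclideanSpace.single i 1) (EuclideanSpace.single j 1) := by
  have hz : z = ∑ j, z j • EuclideanSpace.single j (1 : ℝ) := by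
    ext m; simp [Finset.sum_apply, Pi.single_apply]
  have h1 (w : EuclideanSpace ℝ (Fin n)) :
      B w z = ∑ j, z j * B w (EuclideanSpace.single j 1) := by
    conv_lhs => rw [hz]
    simp
  have h2 (w : EuclideanSpace ℝ (Fin n)) :
      B z w = ∑ j, z j * B (EuclideanSpace.single j 1) w := by
    conv_lhs => rw [hz]
    simp
  rw [h2]
  refine Finset.sum_congr rfl fun i _ => ?_
  rw [h1, Finset.mul_sum]
  exact Finset.sum_congr rfl fun j _ => by ring

theorem linearOp_monomial_mul_radial {n : ℕ} (i : Fin n) (k : ℕ) (a b : ℝ)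
    (c x : EuclideanSpace ℝ (Fin n)) {F F₁ : ℝ → ℝ} {F₂ : ℝ}
    (hF : ∀ᶠ s in 𝓝 (‖x - c‖ ^ 2), HasDerivAt F (F₁ s) s)
    (hF₁ : HasDerivAt F₁ F₂ (‖x - c‖ ^ 2)) {s t : ℝ} (hs : ‖x - c‖ ^ 2 = s) (ht : x i - c i = t) :
    linearOp a b (x - c) (fun y => (y i - c i) ^ k * F (‖y - c‖ ^ 2)) x =
      a * (k * ((k - 1 : ℕ) * t ^ (k - 1 - 1)) * F s + 4 * (k * t ^ (k - 1)) * t * F₁ s +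
        t ^ k * (4 * F₂ * s + 2 * n * F₁ s)) +
      b * (k * ((k - 1 : ℕ) * t ^ (k - 1 - 1)) * F s * t ^ 2 +
        4 * (k * t ^ (k - 1)) * t * s * F₁ s + t ^ k * (4 * F₂ * s ^ 2 + 2 * F₁ s * s)) := by
  have hq : ∑ i', ∑ j, (x - c) i' * (x - c) j *
      hessian (fun y => (y i - c i) ^ k * F (‖y - c‖ ^ 2)) x i' j =
      fderiv ℝ (fderiv ℝ fun y => (y i - c i) ^ k * F (‖y - c‖ ^ 2)) x (x - c) (x - c) := by
    rw [sum_mul_apply_single]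
    rfl
  have htr : (hessian (fun y => (y i - c i) ^ k * F (‖y - c‖ ^ 2)) x).trace =
      k * ((k - 1 : ℕ) * t ^ (k - 1 - 1)) * F s + 4 * (k * t ^ (k - 1)) * t * F₁ s +
        t ^ k * (4 * F₂ * s + 2 * n * F₁ s) := by
    have hs' : s = ∑ j, (x j - c j) ^ 2 := by
      rw [← hs, EuclideanSpace.norm_sq_eq]; simp
    simp only [Matrix.trace, Matrix.diag, hessian, Matrix.of_apply,
      fderiv_fderiv_monomial_mul_radial i k c x hF hF₁, hs, ht]
    have e1 : ∑ j : Fin n, (EuclideanSpace.single j (1 : ℝ) i *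
        EuclideanSpace.single j (1 : ℝ) i) = 1 := by
      simp
    have e2 : ∑ j : Fin n, (2 * inner ℝ (x - c) (EuclideanSpace.single j (1 : ℝ)) *
        EuclideanSpace.single j (1 : ℝ) i +
        2 * inner ℝ (x - c) (EuclideanSpace.single j (1 : ℝ)) *
        EuclideanSpace.single j (1 : ℝ) i) = 4 * t := by
      rw [Finset.sum_add_distrib]
      simp [EuclideanSpace.inner_single_right, ht]; ring
    rw [Finset.sum_add_distrib, Finset.sum_add_distrib, ← Finset.mul_sum, ← Finset.mul_sum,
      ← Finset.mul_sum, e1, e2, Finset.sum_add_distrib]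
    have e3 : ∑ j : Fin n, 4 * F₂ * inner ℝ (x - c) (EuclideanSpace.single j (1 : ℝ)) *
        inner ℝ (x - c) (EuclideanSpace.single j (1 : ℝ)) = 4 * F₂ * s := by
      rw [hs', Finset.mul_sum]
      refine Finset.sum_congr rfl fun j _ => ?_
      simp [EuclideanSpace.inner_single_right]; ring
    rw [e3]
    simp
    ring
  rw [linearOp, hq, htr, fderiv_fderiv_monomial_mul_radial i k c x hF hF₁, real_inner_self_eq_norm_sq,
    hs]
  simp only [PiLp.sub_apply, ht]
  ring

/-! ### Comparison on compact sets, positivity and growth on balls -/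

/-- Look at a minimum point of `u - φ` on `K`: either the inequality is known there, and minimality
spreads it to all of `K`, or the point is interior and `φ` touches `u` from below as a strict
subsolution, which is impossible. -/
theorem IsViscositySupersolution.le_add_of_forall_strict {n : ℕ} {l L : ℝ}
    {f u φ : EuclideanSpace ℝ (Fin n) → ℝ} {Ω K : Set (EuclideanSpace ℝ (Fin n))}
    (hu : IsViscositySupersolution (fun x M => pucciPlus l L M + f x) Ω u)
    (hK : IsCompact K) (hKΩ : K ⊆ Ω) (hφ : ContinuousOn φ K) (ε : ℝ)
    (h : ∀ x ∈ K, φ x ≤ u x + ε ∨ (K ∈ 𝓝 x ∧ ContDiffAt ℝ 2 φ x ∧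
      ∃ a b z, l ≤ a ∧ 0 ≤ b ∧ a + b * ‖z‖ ^ 2 ≤ L ∧ 0 < linearOp a b z φ x + f x)) :
    ∀ x ∈ K, φ x ≤ u x + ε := by
  intro x hx
  obtain ⟨x₀, hx₀, hmin⟩ := hK.exists_isMinOn ⟨x, hx⟩ ((hu.1.mono hKΩ).sub hφ)
  have hle : u x₀ - φ x₀ ≤ u x - φ x := hmin hx
  rcases h x₀ hx₀ with h | ⟨hn, hc, a, b, z, ha, hb, hab, hpos⟩
  · linarith
  · have := hu.linearOp_add_le (hKΩ hx₀) hc (hmin.isLocalMin hn) z ha hb hab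
    linarith

theorem IsViscositySupersolution.le_of_forall_strict {n : ℕ} {l L : ℝ}
    {f u φ : EuclideanSpace ℝ (Fin n) → ℝ} {Ω K : Set (EuclideanSpace ℝ (Fin n))}
    (hu : IsViscositySupersolution (fun x M => pucciPlus l L M + f x) Ω u)
    (hK : IsCompact K) (hKΩ : K ⊆ Ω) (hφ : ContinuousOn φ K)
    (h : ∀ x ∈ K, φ x ≤ u x ∨ (K ∈ 𝓝 x ∧ ContDiffAt ℝ 2 φ x ∧
      ∃ a b z, l ≤ a ∧ 0 ≤ b ∧ a + b * ‖z‖ ^ 2 ≤ L ∧ 0 < linearOp a b z φ x + f x)) :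
    ∀ x ∈ K, φ x ≤ u x := by
  simpa using hu.le_add_of_forall_strict hK hKΩ hφ 0 (by simpa using h)

theorem contDiff_exp_barrier {n : ℕ} (β A δ : ℝ) (c : EuclideanSpace ℝ (Fin n)) :
    ContDiff ℝ 2 fun y => A * (Real.exp (-β * ‖y - c‖ ^ 2) - δ) := by
  have : ContDiff ℝ 2 fun y : EuclideanSpace ℝ (Fin n) => ‖y - c‖ ^ 2 :=
    (contDiff_id.sub contDiff_const).norm_sq ℝ
  fun_prop

theorem linearOp_exp_barrier {n : ℕ} (hn : 0 < n) (L β A δ : ℝ)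
    (c x : EuclideanSpace ℝ (Fin n)) :
    linearOp L 0 (x - c) (fun y => A * (Real.exp (-β * ‖y - c‖ ^ 2) - δ)) x =
      L * A * Real.exp (-β * ‖x - c‖ ^ 2) * (2 * β) * (2 * β * ‖x - c‖ ^ 2 - n) := by
  have h1 (s : ℝ) : HasDerivAt (fun s => A * (Real.exp (-β * s) - δ))
      (A * (Real.exp (-β * s) * -β)) s := by
    have := (((hasDerivAt_id s).const_mul (-β)).exp.sub_const δ).const_mul A
    simpa using this
  have h2 (s : ℝ) : HasDerivAt (fun s => A * (Real.exp (-β * s) * -β))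
      (A * (Real.exp (-β * s) * -β * -β)) s := by
    have := (((hasDerivAt_id s).const_mul (-β)).exp.mul_const (-β)).const_mul A
    simpa using this
  have := linearOp_monomial_mul_radial ⟨0, hn⟩ 0 L 0 c x (Eventually.of_forall h1) (h2 _) rfl rfl
  simp only [pow_zero, one_mul] at this
  rw [this]
  push_cast
  ring

theorem IsViscositySupersolution.pos_on_ball {n : ℕ} (hn : 0 < n) {l L : ℝ} (hl : 0 < l)
    (hlL : l ≤ L) {f u : EuclideanSpace ℝ (Fin n) → ℝ} {Ω : Set (EuclideanSpace ℝ (Fin n))}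
    (hu : IsViscositySupersolution (fun x M => pucciPlus l L M + f x) Ω u)
    (hf : ∀ x ∈ Ω, 0 ≤ f x) (hu0 : ∀ x ∈ Ω, 0 ≤ u x) {y : EuclideanSpace ℝ (Fin n)} {R : ℝ}
    (hR : 0 < R) (hball : Metric.closedBall y R ⊆ Ω) (hy : 0 < u y) :
    ∀ x ∈ Metric.ball y R, 0 < u x := by
  have hn' : (0 : ℝ) < n := by exact_mod_cast hn
  have hcont : ContinuousAt u y := hu.1.continuousAt
    (mem_of_superset (Metric.closedBall_mem_nhds y hR) hball)
  obtain ⟨ρ, hρ, hρu⟩ := Metric.nhds_basis_closedBall.eventually_iff.1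
    (hcont.eventually (lt_mem_nhds (half_lt_self hy)))
  -- The barrier is at most `u y / 2` on the small ball where `u > u y / 2`, and vanishes on the
  -- sphere of radius `R`. The rate `n / ρ²` makes it a strict subsolution in between.
  have key := hu.le_of_forall_strict (isCompact_closedBall y R) hball
    (contDiff_exp_barrier (n / ρ ^ 2) (u y / 2) (Real.exp (-(n / ρ ^ 2) * R ^ 2))
      y).continuous.continuousOn (fun x hx => ?_)
  · intro x hx
    refine lt_of_lt_of_le ?_ (key x (Metric.ball_subset_closedBall hx))
    have hx' : ‖x - y‖ < R := by simpa [dist_eq_norm] using hx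
    refine mul_pos (half_pos hy) (sub_pos.2 (Real.exp_lt_exp.2 ?_))
    have : ‖x - y‖ ^ 2 < R ^ 2 := by gcongr
    have h2 : 0 < n / ρ ^ 2 := by positivity
    nlinarith
  · have hxR : ‖x - y‖ ≤ R := by simpa [dist_eq_norm] using hx
    have h2 : 0 < n / ρ ^ 2 := by positivity
    rcases le_or_gt ‖x - y‖ ρ with h | h
    · left
      have h1 : u y / 2 < u x := hρu (by simpa [dist_eq_norm] using h)
      have h3 : Real.exp (-(n / ρ ^ 2) * ‖x - y‖ ^ 2) ≤ 1 :=
        Real.exp_le_one_iff.2 (by nlinarith [sq_nonneg ‖x - y‖])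
      nlinarith [Real.exp_pos (-(n / ρ ^ 2) * R ^ 2)]
    rcases hxR.eq_or_lt with h' | h'
    · left
      rw [h']; simpa using hu0 x (hball hx)
    · right
      refine ⟨mem_of_superset (Metric.isOpen_ball.mem_nhds (by simpa [dist_eq_norm] using h'))
        Metric.ball_subset_closedBall, (contDiff_exp_barrier ..).contDiffAt, L, 0, x - y, hlL,
        le_rfl, by simp, ?_⟩
      rw [linearOp_exp_barrier hn]
      have h4 : (n : ℝ) < 2 * (n / ρ ^ 2) * ‖x - y‖ ^ 2 := by
        have : n / ρ ^ 2 * ρ ^ 2 < n / ρ ^ 2 * ‖x - y‖ ^ 2 := by gcongr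
        rw [div_mul_cancel₀ _ (by positivity)] at this
        linarith
      have h5 : 0 < L := by linarith
      have := hf x (hball hx)
      have h6 := sub_pos.2 h4
      positivity

/-- Strong minimum principle: the open set where `u > 0` is relatively closed, because a limit point
lies in a ball around a nearby positivity point, and positivity at a centre fills the ball. -/
theorem IsViscositySupersolution.pos {n : ℕ} (hn : 0 < n) {l L : ℝ} (hl : 0 < l)
    (hlL : l ≤ L) {f u : EuclideanSpace ℝ (Fin n) → ℝ} {Ω : Set (EuclideanSpace ℝ (Fin n))}
    (hΩ : IsOpen Ω) (hΩc : IsPreconnected Ω)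
    (hu : IsViscositySupersolution (fun x M => pucciPlus l L M + f x) Ω u)
    (hf : ∀ x ∈ Ω, 0 ≤ f x) (hu0 : ∀ x ∈ Ω, 0 ≤ u x) (hex : ∃ x ∈ Ω, 0 < u x) :
    ∀ x ∈ Ω, 0 < u x := by
  have hopen : IsOpen (Ω ∩ u ⁻¹' Set.Ioi 0) := hu.1.isOpen_inter_preimage hΩ isOpen_Ioi
  obtain ⟨y, hy, hyu⟩ := hex
  have := hΩc.subset_of_closure_inter_subset hopen ⟨y, hy, hy, hyu⟩ ?_
  · exact fun x hx => (this hx).2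
  · rintro x ⟨hxc, hxΩ⟩
    obtain ⟨r, hr, hball⟩ := Metric.isOpen_iff.1 hΩ x hxΩ
    obtain ⟨z, ⟨_, hzu⟩, hxz⟩ := Metric.mem_closure_iff.1 hxc (r / 2) (half_pos hr)
    refine ⟨hxΩ, hu.pos_on_ball hn hl hlL hf hu0 (half_pos hr) ?_ hzu x hxz⟩
    refine (fun w hw => hball ?_)
    rw [Metric.mem_closedBall] at hw
    rw [Metric.mem_ball]
    linarith [dist_triangle w z x, dist_comm x z]

theorem IsViscositySupersolution.le_on_closedBall {n : ℕ} (hn : 0 < n) {l L : ℝ} (hl : 0 < l)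
    (hlL : l ≤ L) {f u : EuclideanSpace ℝ (Fin n) → ℝ} {Ω : Set (EuclideanSpace ℝ (Fin n))}
    (hu : IsViscositySupersolution (fun x M => pucciPlus l L M + f x) Ω u)
    (hf : ∀ x ∈ Ω, 0 ≤ f x) (hu0 : ∀ x ∈ Ω, 0 ≤ u x) {c : EuclideanSpace ℝ (Fin n)} {r μ : ℝ}
    (hr : 0 < r) (hball : Metric.closedBall c (2 * r) ⊆ Ω) (hμ : 0 < μ)
    (hfμ : ∀ x ∈ Metric.closedBall c r, μ ≤ f x) :
    ∀ x ∈ Metric.closedBall c r,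
      (Real.exp (-n) - Real.exp (-(4 * n))) / (4 * n ^ 2 * L) * r ^ 2 * μ ≤ u x := by
  have hn' : (0 : ℝ) < n := by exact_mod_cast hn
  have hL : 0 < L := by linarith
  have hβ : 0 < n / r ^ 2 := by positivity
  have hA : 0 < μ * r ^ 2 / (4 * n ^ 2 * L) := by positivity
  -- With rate `n / r²` the barrier vanishes at radius `2r`, as `β (2r)² = 4n`, and is a strict
  -- subsolution beyond radius `r`. The amplitude is chosen so that its operator is at least `-μ/2`
  -- inside radius `r`, where the source is at least `μ`.
  have key := hu.le_of_forall_strict (isCompact_closedBall c (2 * r)) hball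
    (contDiff_exp_barrier (n / r ^ 2) (μ * r ^ 2 / (4 * n ^ 2 * L)) (Real.exp (-(4 * n)))
      c).continuous.continuousOn (fun x hx => ?_)
  · intro x hx
    have hx' : ‖x - c‖ ≤ r := by simpa [dist_eq_norm] using hx
    refine le_trans ?_ (key x (Metric.closedBall_subset_closedBall (by linarith) hx))
    have h1 : Real.exp (-n) ≤ Real.exp (-(n / r ^ 2) * ‖x - c‖ ^ 2) := by
      refine Real.exp_le_exp.2 ?_
      have : n / r ^ 2 * ‖x - c‖ ^ 2 ≤ n / r ^ 2 * r ^ 2 := by gcongr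
      rw [div_mul_cancel₀ _ (by positivity)] at this
      linarith
    calc _ = μ * r ^ 2 / (4 * n ^ 2 * L) * (Real.exp (-n) - Real.exp (-(4 * n))) := by ring
      _ ≤ _ := by gcongr
  · have hxR : ‖x - c‖ ≤ 2 * r := by simpa [dist_eq_norm] using hx
    rcases hxR.eq_or_lt with h' | h'
    · left
      rw [h', show -(n / r ^ 2) * (2 * r) ^ 2 = -(4 * n) by field_simp; norm_num]
      simpa using hu0 x (hball hx)
    · right
      refine ⟨mem_of_superset (Metric.isOpen_ball.mem_nhds (by simpa [dist_eq_norm] using h'))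
        Metric.ball_subset_closedBall, (contDiff_exp_barrier ..).contDiffAt, L, 0, x - c, hlL,
        le_rfl, by simp, ?_⟩
      rw [linearOp_exp_barrier hn]
      rcases le_or_gt ‖x - c‖ r with h | h
      · have h1 : μ ≤ f x := hfμ x (by simpa [dist_eq_norm] using h)
        have h3 : Real.exp (-(n / r ^ 2) * ‖x - c‖ ^ 2) ≤ 1 :=
          Real.exp_le_one_iff.2 (by nlinarith [sq_nonneg ‖x - c‖])
        have h4 : L * (μ * r ^ 2 / (4 * n ^ 2 * L)) * (2 * (n / r ^ 2)) * n = μ / 2 := by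
          field_simp; norm_num
        have h5 : L * (μ * r ^ 2 / (4 * n ^ 2 * L)) * Real.exp (-(n / r ^ 2) * ‖x - c‖ ^ 2) *
            (2 * (n / r ^ 2)) * (2 * (n / r ^ 2) * ‖x - c‖ ^ 2 - n) ≥
            L * (μ * r ^ 2 / (4 * n ^ 2 * L)) * Real.exp (-(n / r ^ 2) * ‖x - c‖ ^ 2) *
            (2 * (n / r ^ 2)) * (-n) := by
          gcongr
          have : 0 ≤ 2 * (n / r ^ 2) * ‖x - c‖ ^ 2 := by positivity
          linarith
        have h6 : L * (μ * r ^ 2 / (4 * n ^ 2 * L)) * Real.exp (-(n / r ^ 2) * ‖x - c‖ ^ 2) *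
            (2 * (n / r ^ 2)) * n ≤ L * (μ * r ^ 2 / (4 * n ^ 2 * L)) * 1 *
            (2 * (n / r ^ 2)) * n := by gcongr
        linarith
      · have h4 : (n : ℝ) < 2 * (n / r ^ 2) * ‖x - c‖ ^ 2 := by
          have : n / r ^ 2 * r ^ 2 < n / r ^ 2 * ‖x - c‖ ^ 2 := by gcongr
          rw [div_mul_cancel₀ _ (by positivity)] at this
          linarith
        have := hf x (hball hx)
        have h6 := sub_pos.2 h4
        positivity

/-! ### Positivity and the upper bound for the system -/

theorem mem_halfSpace {n : ℕ} {i : Fin n} (hi : (i : ℕ) + 1 = n)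
    {x : EuclideanSpace ℝ (Fin n)} : x ∈ halfSpace n ↔ 0 < x i := by
  refine ⟨?_, fun h => ⟨i, hi, h⟩⟩
  rintro ⟨j, hj, h⟩
  rwa [show i = j from Fin.ext (by omega)]

theorem isPreconnected_halfSpace {n : ℕ} {i : Fin n} (hi : (i : ℕ) + 1 = n) :
    IsPreconnected (halfSpace n) := by
  refine Convex.isPreconnected fun x hx y hy a b ha hb hab => ?_
  rw [mem_halfSpace hi] at hx hy ⊢
  simp only [PiLp.add_apply, PiLp.smul_apply, smul_eq_mul]
  rcases ha.eq_or_lt with rfl | ha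
  · have : b = 1 := by linarith
    subst this; simpa using hy
  · positivity

namespace IsNonnegSystemSupersolution

variable {n : ℕ} {l L p q : ℝ} {u v : EuclideanSpace ℝ (Fin n) → ℝ}

theorem symm (h : IsNonnegSystemSupersolution n l L p q u v) :
    IsNonnegSystemSupersolution n l L q p v u :=
  ⟨h.nonneg_right, h.nonneg_left, h.right, h.left⟩

theorem pos_left (h : IsNonnegSystemSupersolution n l L p q u v) (hn : 0 < n) (hl : 0 < l)
    (hlL : l ≤ L) (hex : ∃ x ∈ halfSpace n, u x ≠ 0) : ∀ x ∈ halfSpace n, 0 < u x := by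
  refine h.left.pos hn hl hlL (isOpen_halfSpace n)
    (isPreconnected_halfSpace (i := ⟨n - 1, by omega⟩) (Nat.sub_add_cancel hn))
    (fun x hx => Real.rpow_nonneg (h.nonneg_right x hx) _) h.nonneg_left ?_
  obtain ⟨x, hx, hne⟩ := hex
  exact ⟨x, hx, (h.nonneg_left x hx).lt_of_ne' hne⟩

theorem pos_of_pos_right (h : IsNonnegSystemSupersolution n l L p q u v) (hn : 0 < n)
    (hlL : l ≤ L) (hv : ∀ x ∈ halfSpace n, 0 < v x) : ∀ x ∈ halfSpace n, 0 < u x := by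
  intro x hx
  refine (h.nonneg_left x hx).lt_of_ne' fun h0 => ?_
  -- At a zero of `u` the zero function touches from below; writing it as a degenerate exponential
  -- barrier lets `linearOp_exp_barrier` evaluate it.
  have h1 : IsLocalMin (fun y => u y - 0 * (Real.exp (-0 * ‖y - x‖ ^ 2) - 0)) x := by
    filter_upwards [(isOpen_halfSpace n).mem_nhds hx] with y hy
    simpa [h0] using h.nonneg_left y hy
  have h2 := h.left.linearOp_add_le hx (contDiff_exp_barrier 0 0 0 x).contDiffAt h1
    (x - x) hlL le_rfl (by simp)
  rw [linearOp_exp_barrier hn] at h2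
  have := Real.rpow_pos_of_pos (hv x hx) p
  simp only [mul_zero, zero_mul, zero_add] at h2
  linarith

theorem exists_rpow_le (h : IsNonnegSystemSupersolution n l L p q u v) (hn : 0 < n) (hl : 0 < l)
    (hlL : l ≤ L) (hp : 0 < p) (hq : 0 < q) (hu : ∀ x ∈ halfSpace n, 0 < u x)
    (hv : ∀ x ∈ halfSpace n, 0 < v x) :
    ∃ κ : ℝ, 0 < κ ∧ ∀ c r, 0 < r → Metric.closedBall c (2 * r) ⊆ halfSpace n →
      ∃ x ∈ Metric.closedBall c r, (κ * r ^ 2) ^ (1 + p) * u x ^ (p * q - 1) ≤ 1 := by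
  have hn' : (0 : ℝ) < n := by exact_mod_cast hn
  have hL : 0 < L := by linarith
  have hκ : 0 < (Real.exp (-n) - Real.exp (-(4 * n))) / (4 * n ^ 2 * L) :=
    div_pos (sub_pos.2 (Real.exp_lt_exp.2 (by linarith))) (by positivity)
  refine ⟨_, hκ, fun c r hr hball => ?_⟩
  have hsub : Metric.closedBall c r ⊆ halfSpace n :=
    (Metric.closedBall_subset_closedBall (by linarith)).trans hball
  have hne : (Metric.closedBall c r).Nonempty := Metric.nonempty_closedBall.2 hr.le
  obtain ⟨x, hx, hxmin⟩ := (isCompact_closedBall c r).exists_isMinOn hne (h.left.1.mono hsub)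
  obtain ⟨y, hy, hymin⟩ := (isCompact_closedBall c r).exists_isMinOn hne (h.right.1.mono hsub)
  have hux := hu x (hsub hx)
  have hvy := hv y (hsub hy)
  have h1 := h.left.le_on_closedBall hn hl hlL
    (fun z hz => Real.rpow_nonneg (h.nonneg_right z hz) _) h.nonneg_left hr hball
    (Real.rpow_pos_of_pos hvy p)
    (fun z hz => Real.rpow_le_rpow hvy.le (hymin hz) hp.le) x hx
  have h2 := h.right.le_on_closedBall hn hl hlL
    (fun z hz => Real.rpow_nonneg (h.nonneg_left z hz) _) h.nonneg_right hr hball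
    (Real.rpow_pos_of_pos hux q)
    (fun z hz => Real.rpow_le_rpow hux.le (hxmin hz) hq.le) y hy
  set κ := (Real.exp (-n) - Real.exp (-(4 * n))) / (4 * n ^ 2 * L)
  have hA : 0 < κ * r ^ 2 := by positivity
  refine ⟨x, hx, ?_⟩
  have h3 : (κ * r ^ 2 * u x ^ q) ^ p ≤ v y ^ p := Real.rpow_le_rpow (by positivity) h2 hp.le
  have h4 : (κ * r ^ 2) ^ (1 + p) * u x ^ (p * q) ≤ u x := by
    calc _ = κ * r ^ 2 * (κ * r ^ 2 * u x ^ q) ^ p := by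
          rw [Real.mul_rpow hA.le (by positivity), ← Real.rpow_mul hux.le, Real.rpow_add hA,
            Real.rpow_one, mul_comm q p, mul_assoc]
      _ ≤ κ * r ^ 2 * v y ^ p := by gcongr
      _ ≤ u x := h1
  rw [Real.rpow_sub_one hux.ne', ← mul_div_assoc]
  exact (div_le_one hux).2 h4

end IsNonnegSystemSupersolution

/-! ### Comparison on the exterior of a half ball -/

theorem linearOp_const_mul {n : ℕ} (a b : ℝ) (z : EuclideanSpace ℝ (Fin n)) (η : ℝ)
    {φ : EuclideanSpace ℝ (Fin n) → ℝ} {x : EuclideanSpace ℝ (Fin n)} (hφ : ContDiffAt ℝ 2 φ x) :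
    linearOp a b z (fun y => η * φ y) x = η * linearOp a b z φ x := by
  have key : hessian (fun y => η * φ y) x = η • hessian φ x := by
    have h1 : fderiv ℝ (fun y => η * φ y) =ᶠ[𝓝 x] fun y => η • fderiv ℝ φ y := by
      filter_upwards [hφ.eventually (by simp)] with y h1
      exact fderiv_const_mul (h1.differentiableAt (by simp)) η
    have d1 : DifferentiableAt ℝ (fderiv ℝ φ) x :=
      (hφ.fderiv_right (m := 1) (by norm_num)).differentiableAt (by simp)
    ext i j
    simp [hessian, h1.fderiv_eq, fderiv_fun_const_smul d1]
  simp only [linearOp, key, Matrix.trace_smul, Matrix.smul_apply, smul_eq_mul, mul_add,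
    Finset.mul_sum]
  congr 1
  · ring
  · exact Finset.sum_congr rfl fun i _ => Finset.sum_congr rfl fun j _ => by ring

/-- Since `c i > 0`, the closed region, flat face included, lies in the open half space, so no
boundary condition is needed. On the half sphere `u` has a positive minimum, on the face `Ψ ≤ 0`,
and decay of `Ψ` lets one truncate at a large radius at the cost of `ε`. -/
theorem IsViscositySupersolution.exists_mul_le_at_infinity {n : ℕ} {i : Fin n}
    (hi : (i : ℕ) + 1 = n) {l L : ℝ} {f u Ψ : EuclideanSpace ℝ (Fin n) → ℝ}
    (hu : IsViscositySupersolution (fun x M => pucciPlus l L M + f x) (halfSpace n) u)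
    (hpos : ∀ x ∈ halfSpace n, 0 < u x) {c : EuclideanSpace ℝ (Fin n)} (hc : 0 < c i)
    (hΨ : ∀ x, x ≠ c → ContDiffAt ℝ 2 Ψ x) (h1 : ∀ x, ‖x - c‖ = 1 → Ψ x ≤ 1)
    (h0 : ∀ x, x i - c i = 0 → Ψ x ≤ 0) {g : ℝ → ℝ} (hg : Tendsto g atTop (𝓝 0))
    (hΨg : ∀ x, 1 ≤ ‖x - c‖ → Ψ x ≤ g ‖x - c‖) {η₀ : ℝ} (hη₀ : 0 < η₀)
    (hstrict : ∀ η, 0 < η → η ≤ η₀ → ∀ x, 1 < ‖x - c‖ → 0 < x i - c i →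
      ∃ a b z, l ≤ a ∧ 0 ≤ b ∧ a + b * ‖z‖ ^ 2 ≤ L ∧ 0 < η * linearOp a b z Ψ x + f x) :
    ∃ η, 0 < η ∧ ∀ x, 1 ≤ ‖x - c‖ → 0 ≤ x i - c i → η * Ψ x ≤ u x := by
  have hcl : IsClosed {x : EuclideanSpace ℝ (Fin n) | 0 ≤ x i - c i} :=
    isClosed_le continuous_const (by fun_prop)
  have hΩ {x : EuclideanSpace ℝ (Fin n)} (hx : 0 ≤ x i - c i) : x ∈ halfSpace n :=
    (mem_halfSpace hi).2 (by linarith)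
  obtain ⟨m, hm, hmu⟩ : ∃ m, 0 < m ∧ ∀ x, ‖x - c‖ = 1 → 0 ≤ x i - c i → m ≤ u x := by
    have hS : IsCompact (Metric.sphere c 1 ∩ {x : EuclideanSpace ℝ (Fin n) | 0 ≤ x i - c i}) :=
      (isCompact_sphere c 1).inter_right hcl
    have hne : (Metric.sphere c 1 ∩
        {x : EuclideanSpace ℝ (Fin n) | 0 ≤ x i - c i}).Nonempty :=
      ⟨c + EuclideanSpace.single i 1, by simp, by simp⟩
    obtain ⟨x₀, hx₀, hmin⟩ := hS.exists_isMinOn hne (hu.1.mono fun x hx => hΩ hx.2)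
    exact ⟨u x₀, hpos _ (hΩ hx₀.2), fun x hx hx' => hmin ⟨by simpa [dist_eq_norm] using hx, hx'⟩⟩
  have hη : 0 < min η₀ m := lt_min hη₀ hm
  refine ⟨min η₀ m, hη, fun x hx hxi => le_of_forall_pos_le_add fun ε hε => ?_⟩
  have hηg : Tendsto (fun r => min η₀ m * g r) atTop (𝓝 0) := by simpa using hg.const_mul _
  obtain ⟨ρ, hρε, hρx⟩ := ((hηg.eventually (gt_mem_nhds hε)).and
    (eventually_gt_atTop ‖x - c‖)).exists
  let K : Set (EuclideanSpace ℝ (Fin n)) :=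
    Metric.closedBall c ρ ∩ ({x | 1 ≤ ‖x - c‖} ∩ {x | 0 ≤ x i - c i})
  have hK : IsCompact K := (isCompact_closedBall c ρ).inter_right
    ((isClosed_le continuous_const (by fun_prop)).inter hcl)
  have hne {y : EuclideanSpace ℝ (Fin n)} (hy : 1 ≤ ‖y - c‖) : y ≠ c := by
    rintro rfl
    norm_num at hy
  refine hu.le_add_of_forall_strict hK (fun y hy => hΩ hy.2.2) (φ := fun y => min η₀ m * Ψ y)
    (fun y hy => ((hΨ y (hne hy.2.1)).continuousAt.const_mul _).continuousWithinAt) ε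
    (fun y hy => ?_) x ⟨by simpa [dist_eq_norm] using hρx.le, hx, hxi⟩
  obtain ⟨hy1, hy2, hy3⟩ := hy
  have hyu := hpos y (hΩ hy3)
  simp only [Metric.mem_closedBall, dist_eq_norm, Set.mem_ofPred_eq] at hy1 hy2 hy3
  rcases hy1.eq_or_lt with hy1 | hy1
  · left
    have := mul_le_mul_of_nonneg_left (hΨg y hy2) hη.le
    rw [hy1] at this
    linarith
  rcases hy2.eq_or_lt with hy2 | hy2
  · left
    have h2 := mul_le_mul_of_nonneg_left (h1 y hy2.symm) hη.le
    have h3 := hmu y hy2.symm hy3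
    have h4 := min_le_right η₀ m
    linarith
  rcases hy3.eq_or_lt with hy3 | hy3
  · left
    have := mul_le_mul_of_nonneg_left (h0 y hy3.symm) hη.le
    linarith
  right
  have hc2 := hΨ y (hne hy2.le)
  refine ⟨?_, contDiffAt_const.mul hc2, ?_⟩
  · have e1 : Continuous fun y : EuclideanSpace ℝ (Fin n) => ‖y - c‖ := by fun_prop
    have e2 : Continuous fun y : EuclideanSpace ℝ (Fin n) => y i - c i := by fun_prop
    filter_upwards [(isOpen_lt e1 continuous_const).mem_nhds hy1,
      (isOpen_lt continuous_const e1).mem_nhds hy2,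
      (isOpen_lt continuous_const e2).mem_nhds hy3] with w hw1 hw2 hw3
    exact ⟨by simpa [dist_eq_norm] using le_of_lt hw1, le_of_lt hw2, le_of_lt hw3⟩
  · obtain ⟨a, b, z, ha, hb, hab, hlt⟩ := hstrict _ hη (min_le_left _ _) y hy2 hy3
    exact ⟨a, b, z, ha, hb, hab, by rwa [linearOp_const_mul _ _ _ _ hc2]⟩

/-! ### The singular solution and its logarithmic correction -/

section Radial

variable {n : ℕ} (i : Fin n) {l L N : ℝ} (c x : EuclideanSpace ℝ (Fin n)) {F F₁ : ℝ → ℝ} {F₂ : ℝ}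

theorem linearOp_linear_mul_radial (hN : L * (N - 1) = l * (n - 1))
    (hF : ∀ᶠ s in 𝓝 (‖x - c‖ ^ 2), HasDerivAt F (F₁ s) s)
    (hF₁ : HasDerivAt F₁ F₂ (‖x - c‖ ^ 2)) {s t : ℝ} (hs : ‖x - c‖ ^ 2 = s) (hs0 : s ≠ 0)
    (ht : x i - c i = t) :
    linearOp l ((L - l) / s) (x - c) (fun y => (y i - c i) * F (‖y - c‖ ^ 2)) x =
      2 * L * t * (2 * s * F₂ + (N + 2) * F₁ s) := by
  have := linearOp_monomial_mul_radial i 1 l ((L - l) / s) c x hF hF₁ hs ht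
  simp only [pow_one] at this
  rw [this]
  push_cast
  field_simp
  linear_combination (-(t * s * F₁ s * 2)) * hN

theorem linearOp_cube_mul_radial (hN : L * (N - 1) = l * (n - 1))
    (hF : ∀ᶠ s in 𝓝 (‖x - c‖ ^ 2), HasDerivAt F (F₁ s) s)
    (hF₁ : HasDerivAt F₁ F₂ (‖x - c‖ ^ 2)) {s t : ℝ} (hs : ‖x - c‖ ^ 2 = s) (hs0 : s ≠ 0)
    (ht : x i - c i = t) :
    linearOp l ((L - l) / s) (x - c) (fun y => (y i - c i) ^ 3 * F (‖y - c‖ ^ 2)) x =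
      6 * l * t * F s + t ^ 3 * (L * (4 * s * F₂ + (12 + 2 * N) * F₁ s) +
        6 * (L - l) * F s / s) := by
  rw [linearOp_monomial_mul_radial i 3 l ((L - l) / s) c x hF hF₁ hs ht]
  norm_num
  field_simp
  linear_combination (-(t ^ 3 * s * F₁ s * 2)) * hN

end Radial

theorem hasDerivAt_mul_rpow (θ α : ℝ) {s : ℝ} (hs : 0 < s) :
    HasDerivAt (fun s => θ * s ^ α) (θ * α * s ^ (α - 1)) s := by
  have := (Real.hasDerivAt_rpow_const (p := α) (Or.inl hs.ne')).const_mul θ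
  exact this.congr_deriv (by ring)

theorem linearOp_pow_sub_eq_zero {n : ℕ} (i : Fin n) {l L N : ℝ} (hN : L * (N - 1) = l * (n - 1))
    (c x : EuclideanSpace ℝ (Fin n)) (hx : x ≠ c) :
    linearOp l ((L - l) / ‖x - c‖ ^ 2) (x - c)
      (fun y => (y i - c i) * (1 * (‖y - c‖ ^ 2) ^ (-(N / 2)))) x = 0 := by
  have hs : 0 < ‖x - c‖ ^ 2 := by have := norm_pos_iff.2 (sub_ne_zero.2 hx); positivity
  rw [linearOp_linear_mul_radial i c x hN (F := fun s => 1 * s ^ (-(N / 2)))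
    ((lt_mem_nhds hs).mono fun s h => hasDerivAt_mul_rpow _ _ h) (hasDerivAt_mul_rpow _ _ hs)
    rfl hs.ne' rfl]
  rw [Real.rpow_sub_one hs.ne' (-(N / 2) - 1)]
  generalize ‖x - c‖ ^ 2 = s at hs
  field_simp
  ring

/-- The logarithmic correction `θ s^(-N/2) log s + t² s^(-N/2-1)` to the singular solution. -/
theorem le_linearOp_log {n : ℕ} (i : Fin n) {l L N : ℝ} (hN : L * (N - 1) = l * (n - 1))
    (hL : 0 < L) (hlL : l ≤ L) (hN0 : 0 < N) (c x : EuclideanSpace ℝ (Fin n)) (hx : x ≠ c)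
    (hxi : 0 < x i - c i) :
    -(2 * (N + 2) * L) * ((x i - c i) ^ 3 * (‖x - c‖ ^ 2) ^ (-(N / 2) - 2)) ≤
    linearOp l ((L - l) / ‖x - c‖ ^ 2) (x - c)
      (fun y => (y i - c i) * (3 * l / (L * N) * (‖y - c‖ ^ 2) ^ (-(N / 2)) *
        Real.log (‖y - c‖ ^ 2)) +
        (y i - c i) ^ 3 * (1 * (‖y - c‖ ^ 2) ^ (-(N / 2) - 1))) x := by
  have hs : 0 < ‖x - c‖ ^ 2 := by have := norm_pos_iff.2 (sub_ne_zero.2 hx); positivity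
  set θ := 3 * l / (L * N) with hθ
  set α := -(N / 2) with hα
  have hlog1 {s : ℝ} (h : 0 < s) : HasDerivAt (fun s => θ * s ^ α * Real.log s)
      (θ * α * s ^ (α - 1) * Real.log s + θ * s ^ (α - 1)) s := by
    refine ((hasDerivAt_mul_rpow θ α h).mul (Real.hasDerivAt_log h.ne')).congr_deriv ?_
    rw [Real.rpow_sub_one h.ne']; field_simp
  have hlog2 {s : ℝ} (h : 0 < s) : HasDerivAt
      (fun s => θ * α * s ^ (α - 1) * Real.log s + θ * s ^ (α - 1))
      (θ * α * (α - 1) * s ^ (α - 1 - 1) * Real.log s + θ * α * s ^ (α - 1) * s⁻¹ +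
        θ * (α - 1) * s ^ (α - 1 - 1)) s :=
    ((hasDerivAt_mul_rpow (θ * α) (α - 1) h).mul (Real.hasDerivAt_log h.ne')).add
      (hasDerivAt_mul_rpow θ (α - 1) h)
  have hcs : ContDiffAt ℝ 2 (fun s : ℝ => θ * s ^ α * Real.log s) (‖x - c‖ ^ 2) :=
    (contDiffAt_const.mul (Real.contDiffAt_rpow_const_of_ne hs.ne')).mul
      (Real.contDiffAt_log.2 hs.ne')
  have hcs' : ContDiffAt ℝ 2 (fun s : ℝ => 1 * s ^ (α - 1)) (‖x - c‖ ^ 2) :=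
    contDiffAt_const.mul (Real.contDiffAt_rpow_const_of_ne hs.ne')
  have hc1 := contDiffAt_monomial_mul_radial i 1 c x hcs
  simp only [pow_one] at hc1
  rw [linearOp_add _ _ _ hc1 (contDiffAt_monomial_mul_radial i 3 c x hcs'),
    linearOp_linear_mul_radial i c x hN (F := fun s => θ * s ^ α * Real.log s)
    ((lt_mem_nhds hs).mono fun s h => hlog1 h) (hlog2 hs) rfl hs.ne' rfl,
    linearOp_cube_mul_radial i c x hN (F := fun s => 1 * s ^ (α - 1))
    ((lt_mem_nhds hs).mono fun s h => hasDerivAt_mul_rpow _ _ h) (hasDerivAt_mul_rpow _ _ hs)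
    rfl hs.ne' rfl]
  set s := ‖x - c‖ ^ 2
  set t := x i - c i
  have e2 : s ^ (α - 1 - 1) = s ^ (α - 1) / s := Real.rpow_sub_one hs.ne' _
  have e3 : s ^ (α - 1 - 1 - 1) = s ^ (α - 1) / s / s := by
    rw [Real.rpow_sub_one hs.ne', e2]
  have e4 : s ^ (α - 2) = s ^ (α - 1) / s := by rw [← e2]; ring_nf
  have hP : 0 < s ^ (α - 1) := Real.rpow_pos_of_pos hs _
  rw [e2, e3, e4]
  generalize s ^ (α - 1) = P at hP
  -- The `log s` terms cancel because `t s^(-N/2)` is a solution. What the logarithm leaves is `-2 L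
  -- N θ t P`, and `θ = 3 l / (L N)` makes it cancel the term `6 l t P` coming from the cube.
  have key : 2 * L * t * (2 * s * (θ * α * (α - 1) * (P / s) * Real.log s + θ * α * P * s⁻¹ +
      θ * (α - 1) * (P / s)) + (N + 2) * (θ * α * P * Real.log s + θ * P)) +
      (6 * l * t * (1 * P) + t ^ 3 * (L * (4 * s * (1 * (α - 1) * (α - 1 - 1) * (P / s / s)) +
        (12 + 2 * N) * (1 * (α - 1) * (P / s))) + 6 * (L - l) * (1 * P) / s)) =
      -(2 * (N + 2) * L) * (t ^ 3 * (P / s)) + t ^ 3 * (6 * (L - l) * P / s) := by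
    rw [hθ, hα]
    field_simp
    ring
  have : 0 ≤ t ^ 3 * (6 * (L - l) * P / s) := by
    have := sub_nonneg.2 hlL
    positivity
  convert (le_add_of_nonneg_right this).trans_eq key.symm using 1

theorem sq_rpow {r : ℝ} (hr : 0 ≤ r) (α : ℝ) : (r ^ 2) ^ α = r ^ (2 * α) := by
  rw [← Real.rpow_natCast, ← Real.rpow_mul hr]; norm_num

theorem apply_sub_le_norm {n : ℕ} (i : Fin n) (c x : EuclideanSpace ℝ (Fin n)) :
    x i - c i ≤ ‖x - c‖ :=
  (le_abs_self _).trans (by simpa using PiLp.norm_apply_le (x - c) i)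

theorem radial_weight_admissible {n : ℕ} {l L : ℝ} {c x : EuclideanSpace ℝ (Fin n)}
    (hx : x ≠ c) : l + (L - l) / ‖x - c‖ ^ 2 * ‖x - c‖ ^ 2 ≤ L := by
  have := norm_pos_iff.2 (sub_ne_zero.2 hx)
  rw [div_mul_cancel₀ _ (by positivity)]
  linarith

/-! ### Lower bounds at infinity -/

namespace IsNonnegSystemSupersolution

variable {n : ℕ} {i : Fin n} {l L p q N : ℝ} {u v : EuclideanSpace ℝ (Fin n) → ℝ}
  {c : EuclideanSpace ℝ (Fin n)}

/-- The minorant vanishes exactly on the singular solution; the strictness required by comparison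
comes from the source `v^p > 0`. -/
theorem exists_singular_le (h : IsNonnegSystemSupersolution n l L p q u v)
    (hi : (i : ℕ) + 1 = n) (hlL : l ≤ L) (hu : ∀ x ∈ halfSpace n, 0 < u x)
    (hv : ∀ x ∈ halfSpace n, 0 < v x) (hc : 0 < c i) (hN : L * (N - 1) = l * (n - 1))
    (hN1 : 1 < N) :
    ∃ η, 0 < η ∧ ∀ x, 1 ≤ ‖x - c‖ → 0 ≤ x i - c i →
      η * ((x i - c i) * (1 * (‖x - c‖ ^ 2) ^ (-(N / 2)))) ≤ u x := by
  refine h.left.exists_mul_le_at_infinity hi hu hc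
    (Ψ := fun x => (x i - c i) * (1 * (‖x - c‖ ^ 2) ^ (-(N / 2)))) (fun x hx => ?_)
    (fun x hx => ?_) (fun x hx => by simp [hx]) (tendsto_rpow_neg_atTop (sub_pos.2 hN1))
    (fun x hx => ?_) one_pos (fun η hη _ x hx hxi => ?_)
  · have hs : ‖x - c‖ ^ 2 ≠ 0 := pow_ne_zero _ (norm_ne_zero_iff.2 (sub_ne_zero.2 hx))
    simpa only [pow_one] using contDiffAt_monomial_mul_radial i 1 c x
      (F := fun s => 1 * s ^ (-(N / 2)))
      (contDiffAt_const.mul (Real.contDiffAt_rpow_const_of_ne hs))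
  · have := apply_sub_le_norm i c x
    simpa [hx] using this
  · have hr : 0 < ‖x - c‖ := by linarith
    calc _ ≤ ‖x - c‖ * (1 * (‖x - c‖ ^ 2) ^ (-(N / 2))) := by
          gcongr; exact apply_sub_le_norm i c x
      _ = _ := by
          rw [one_mul, sq_rpow hr.le, ← Real.rpow_one_add' hr.le (by linarith)]
          ring_nf
  · have hxc : x ≠ c := by
      rintro rfl
      norm_num at hx
    refine ⟨l, (L - l) / ‖x - c‖ ^ 2, x - c, le_rfl, div_nonneg (by linarith) (by positivity),
      radial_weight_admissible hxc, ?_⟩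
    rw [linearOp_pow_sub_eq_zero i hN c x hxc, mul_zero, zero_add]
    exact Real.rpow_pos_of_pos (hv x ((mem_halfSpace hi).2 (by linarith))) _

theorem exists_log_le (h : IsNonnegSystemSupersolution n l L p q u v)
    (hi : (i : ℕ) + 1 = n) (hl : 0 < l) (hlL : l ≤ L) (hu : ∀ x ∈ halfSpace n, 0 < u x)
    (hv : ∀ x ∈ halfSpace n, 0 < v x) (hc : 0 < c i) (hN : L * (N - 1) = l * (n - 1))
    (hN2 : 2 ≤ N) (hp : p * (N - 1) = N + 1) :
    ∃ η, 0 < η ∧ ∀ x, 1 ≤ ‖x - c‖ → 0 ≤ x i - c i →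
      η * ((x i - c i) * (3 * l / (L * N) * (‖x - c‖ ^ 2) ^ (-(N / 2)) *
        Real.log (‖x - c‖ ^ 2)) +
        (x i - c i) ^ 3 * (1 * (‖x - c‖ ^ 2) ^ (-(N / 2) - 1))) ≤ u x := by
  have hL : 0 < L := by linarith
  have hp0 : 0 < p := by
    by_contra hneg
    nlinarith
  -- This is where `N ≥ 2` enters: `p = (N + 1) / (N - 1) ≤ 3`.
  have hp3 : p ≤ 3 := by
    by_contra hneg
    nlinarith
  obtain ⟨η₁, hη₁, hη₁v⟩ := h.symm.exists_singular_le hi hlL hv hu hc hN (by linarith)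
  set θ := 3 * l / (L * N) with hθ
  have hθ0 : 0 < θ := by positivity
  have hg : Tendsto (fun r : ℝ => r ^ (-(N - 1)) * (θ * (2 * Real.log r)) + r ^ (-(N - 1)))
      atTop (𝓝 0) := by
    have h1 := (isLittleO_log_rpow_atTop (r := N - 1) (by linarith)).tendsto_div_nhds_zero
    have h2 : Tendsto (fun r : ℝ => r ^ (-(N - 1))) atTop (𝓝 0) :=
      tendsto_rpow_neg_atTop (by linarith)
    have h3 := (h1.const_mul (2 * θ)).add h2
    simp only [mul_zero, add_zero] at h3
    refine h3.congr' ?_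
    filter_upwards [eventually_gt_atTop 0] with r hr
    rw [Real.rpow_neg hr.le]
    ring
  refine h.left.exists_mul_le_at_infinity hi hu hc
    (Ψ := fun x => (x i - c i) * (θ * (‖x - c‖ ^ 2) ^ (-(N / 2)) * Real.log (‖x - c‖ ^ 2)) +
        (x i - c i) ^ 3 * (1 * (‖x - c‖ ^ 2) ^ (-(N / 2) - 1))) (fun x hx => ?_)
    (fun x hx => ?_) (fun x hx => by simp [hx]) hg
    -- With this bound on `η`, the negative part of the operator uses at most half of the source
    -- `v^p`.
    (fun x hx => ?_) (η₀ := η₁ ^ p / (4 * (N + 2) * L)) (by positivity)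
    (fun η hη hη0 x hx hxi => ?_)
  · have hs : ‖x - c‖ ^ 2 ≠ 0 := pow_ne_zero _ (norm_ne_zero_iff.2 (sub_ne_zero.2 hx))
    have h1 := contDiffAt_monomial_mul_radial i 1 c x
      (F := fun s => θ * s ^ (-(N / 2)) * Real.log s)
      ((contDiffAt_const.mul (Real.contDiffAt_rpow_const_of_ne hs)).mul
        (Real.contDiffAt_log.2 hs))
    simp only [pow_one] at h1
    exact h1.add (contDiffAt_monomial_mul_radial i 3 c x (F := fun s => 1 * s ^ (-(N / 2) - 1))
      (contDiffAt_const.mul (Real.contDiffAt_rpow_const_of_ne hs)))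
  · have := apply_sub_le_norm i c x
    rw [hx] at this
    have h3 : (x i - c i) ^ 3 ≤ 1 ^ 3 := Odd.pow_le_pow (by decide) |>.2 this
    simpa [hx] using h3
  · have hr : 0 < ‖x - c‖ := by linarith
    have hlog : 0 ≤ Real.log (‖x - c‖ ^ 2) := Real.log_nonneg (one_le_pow₀ hx)
    have ht := apply_sub_le_norm i c x
    calc _ ≤ ‖x - c‖ * (θ * (‖x - c‖ ^ 2) ^ (-(N / 2)) * Real.log (‖x - c‖ ^ 2)) +
        ‖x - c‖ ^ 3 * (1 * (‖x - c‖ ^ 2) ^ (-(N / 2) - 1)) := by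
          have : (x i - c i) ^ 3 ≤ ‖x - c‖ ^ 3 := Odd.pow_le_pow (by decide) |>.2 ht
          gcongr
      _ = _ := by
          have e1 : ‖x - c‖ * (‖x - c‖ ^ 2) ^ (-(N / 2)) = ‖x - c‖ ^ (-(N - 1)) := by
            rw [sq_rpow hr.le, ← Real.rpow_one_add' hr.le (by linarith)]
            ring_nf
          rw [Real.rpow_sub_one (by positivity), Real.log_pow, ← e1]
          push_cast
          field_simp
  · have hxc : x ≠ c := by
      rintro rfl
      norm_num at hx
    refine ⟨l, (L - l) / ‖x - c‖ ^ 2, x - c, le_rfl, div_nonneg (by linarith) (by positivity),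
      radial_weight_admissible hxc, ?_⟩
    have h1 := mul_le_mul_of_nonneg_left
      (le_linearOp_log i hN hL hlL (by linarith) c x hxc hxi) hη.le
    have h2 := hη₁v x hx.le hxi.le
    have ht := apply_sub_le_norm i c x
    have hr : 0 < ‖x - c‖ := by linarith
    rw [← hθ] at h1
    set r := ‖x - c‖
    set t := x i - c i
    have h3 := Real.rpow_le_rpow (by positivity) h2 hp0.le
    -- In terms of `w ∈ (0, 1]` the source is at least a multiple of `w^p r^(-(N+1))` and the error
    -- is a multiple of `w³ r^(-(N+1))`. So `p ≤ 3` gives domination up to the flat face, where `w →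
    -- 0`.
    set w := t / r with hw
    have hw0 : 0 < w := by positivity
    have hw1 : w ≤ 1 := (div_le_one hr).2 ht
    have htw : t = w * r := by rw [hw]; field_simp
    have hY : (η₁ * (t * (1 * (r ^ 2) ^ (-(N / 2))))) ^ p = η₁ ^ p * (w ^ p * r ^ (-(N + 1))) := by
      have e1 : η₁ * (t * (1 * (r ^ 2) ^ (-(N / 2)))) = η₁ * (w * r ^ (1 - N)) := by
        rw [sq_rpow hr.le, htw, one_mul, mul_assoc w, ← Real.rpow_one_add' hr.le (by linarith)]
        ring_nf
      rw [e1, Real.mul_rpow hη₁.le (by positivity), Real.mul_rpow hw0.le (by positivity),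
        ← Real.rpow_mul hr.le, show (1 - N) * p = -(N + 1) by linarith]
    have hX : t ^ 3 * (r ^ 2) ^ (-(N / 2) - 2) = w ^ (3 : ℝ) * r ^ (-(N + 1)) := by
      rw [sq_rpow hr.le, htw, mul_pow, mul_assoc, ← Real.rpow_natCast r, ← Real.rpow_add hr,
        ← Real.rpow_natCast w]
      norm_num
      left
      ring_nf
    have hXY : w ^ (3 : ℝ) ≤ w ^ p := Real.rpow_le_rpow_of_exponent_ge hw0 hw1 hp3
    rw [hY] at h3
    rw [hX] at h1
    have hZ : 0 < w ^ p * r ^ (-(N + 1)) := by positivity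
    have h4 : η * (2 * (N + 2) * L) ≤ η₁ ^ p / 2 := by
      calc _ ≤ η₁ ^ p / (4 * (N + 2) * L) * (2 * (N + 2) * L) := by gcongr
        _ = _ := by field_simp; norm_num
    have h5 : η * (2 * (N + 2) * L) * (w ^ (3 : ℝ) * r ^ (-(N + 1))) ≤
        η₁ ^ p / 2 * (w ^ p * r ^ (-(N + 1))) := by gcongr
    have h6 : 0 < η₁ ^ p * (w ^ p * r ^ (-(N + 1))) := by positivity
    linarith

/-! ### Contradictions in the three cases -/

/-- Lower bounds on balls of radius `r` at height comparable to `r` contradict the upper bounds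
that the system forces there. -/
theorem false_of_lower_bound (h : IsNonnegSystemSupersolution n l L p q u v) (hi : (i : ℕ) + 1 = n)
    (hl : 0 < l) (hlL : l ≤ L) (hp : 0 < p) (hq : 0 < q) (hu : ∀ x ∈ halfSpace n, 0 < u x)
    (hv : ∀ x ∈ halfSpace n, 0 < v x) (hc : 0 ≤ c i) (hpq : 1 < p * q) {η : ℝ} (hη : 0 < η)
    {g : ℝ → ℝ} (hg : ∀ᶠ r in atTop, 0 < g r)
    (hlow : ∀ r x, 1 ≤ r → 3 * r ≤ x i - c i → 3 * r ≤ ‖x - c‖ → ‖x - c‖ ≤ 5 * r →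
      η * (r ^ (1 - N) * g r) ≤ u x)
    (hlim : Tendsto (fun r => r ^ (2 * (p + 1) - (N - 1) * (p * q - 1)) * g r ^ (p * q - 1))
      atTop atTop) : False := by
  obtain ⟨κ, hκ, hle⟩ := h.exists_rpow_le i.pos hl hlL hp hq hu hv
  have hconst : 0 < κ ^ (1 + p) * η ^ (p * q - 1) := by positivity
  obtain ⟨r, hr, hgr, hlt⟩ := ((eventually_ge_atTop 1).and (hg.and
    ((hlim.const_mul_atTop hconst).eventually_gt_atTop 1))).exists
  have hr0 : 0 < r := by linarith
  have hcoord (x y : EuclideanSpace ℝ (Fin n)) : |x i - y i| ≤ dist x y := by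
    simpa [dist_eq_norm] using PiLp.norm_apply_le (x - y) i
  -- At height `4r` above `c` the ball of radius `2r` stays in the half space, and the ball of
  -- radius `r` lies in the region covered by `hlow`.
  let y := c + EuclideanSpace.single i (4 * r)
  have hy : y i = c i + 4 * r := by simp [y]
  have hyc : dist y c = 4 * r := by simp [y, dist_eq_norm, abs_of_pos hr0]
  obtain ⟨x, hx, hxle⟩ := hle y r hr0 fun x hx => by
    have h1 := (abs_le.1 ((hcoord x y).trans hx)).1
    rw [mem_halfSpace hi]
    linarith
  rw [Metric.mem_closedBall] at hx
  have h1 := (abs_le.1 ((hcoord x y).trans hx)).1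
  have h2 := hlow r x hr (by linarith)
    (by rw [← dist_eq_norm]; linarith [dist_triangle y x c, dist_comm x y])
    (by rw [← dist_eq_norm]; linarith [dist_triangle x y c])
  have h3 : (η * (r ^ (1 - N) * g r)) ^ (p * q - 1) ≤ u x ^ (p * q - 1) :=
    Real.rpow_le_rpow (by positivity) h2 (by linarith)
  have h4 : (κ * r ^ 2) ^ (1 + p) * (η * (r ^ (1 - N) * g r)) ^ (p * q - 1) ≤ 1 :=
    (mul_le_mul_of_nonneg_left h3 (by positivity)).trans hxle
  have h5 : (κ * r ^ 2) ^ (1 + p) * (η * (r ^ (1 - N) * g r)) ^ (p * q - 1) =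
      κ ^ (1 + p) * η ^ (p * q - 1) *
        (r ^ (2 * (p + 1) - (N - 1) * (p * q - 1)) * g r ^ (p * q - 1)) := by
    rw [Real.mul_rpow hκ.le (by positivity), Real.mul_rpow hη.le (by positivity),
      Real.mul_rpow (by positivity) hgr.le, sq_rpow hr0.le, ← Real.rpow_mul hr0.le,
      show 2 * (p + 1) - (N - 1) * (p * q - 1) = 2 * (1 + p) + (1 - N) * (p * q - 1) by ring,
      Real.rpow_add hr0]
    ring
  linarith

theorem false_of_subcritical (h : IsNonnegSystemSupersolution n l L p q u v)
    (hi : (i : ℕ) + 1 = n)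
    (hl : 0 < l) (hlL : l ≤ L) (hp : 0 < p) (hq : 0 < q) (hu : ∀ x ∈ halfSpace n, 0 < u x)
    (hv : ∀ x ∈ halfSpace n, 0 < v x) (hN : L * (N - 1) = l * (n - 1)) (hN1 : 1 < N)
    (hpq : 1 < p * q) (hsub : N - 1 < 2 * (p + 1) / (p * q - 1)) : False := by
  let c : EuclideanSpace ℝ (Fin n) := EuclideanSpace.single i 1
  have hc : 0 < c i := by simp [c]
  obtain ⟨η, hη, hle⟩ := h.exists_singular_le hi hlL hu hv hc hN hN1
  rw [lt_div_iff₀ (by linarith)] at hsub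
  refine h.false_of_lower_bound (N := N) (c := c) hi hl hlL hp hq hu hv hc.le hpq
    (η := η * (3 * 5 ^ (-N))) (g := fun _ => 1) (by positivity) (by simp)
    (fun r x hr h1 h2 h3 => (le_trans ?_ (hle x (by linarith) (by linarith)))) ?_
  · have hr0 : 0 < r := by linarith
    rw [mul_assoc η]
    refine mul_le_mul_of_nonneg_left ?_ hη.le
    rw [sq_rpow (norm_nonneg _), one_mul, mul_one, show 2 * -(N / 2) = -N by ring]
    calc _ = 3 * r * (5 * r) ^ (-N) := by
          rw [Real.mul_rpow (by norm_num) hr0.le, sub_eq_add_neg, Real.rpow_add hr0, Real.rpow_one]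
          ring
      _ ≤ _ := mul_le_mul h1 (Real.rpow_le_rpow_of_nonpos (by linarith) h3 (by linarith))
        (by positivity) (by linarith)
  · simpa using tendsto_rpow_atTop (sub_pos.2 hsub)

theorem false_of_critical (h : IsNonnegSystemSupersolution n l L p p u v)
    (hi : (i : ℕ) + 1 = n)
    (hl : 0 < l) (hlL : l ≤ L) (hu : ∀ x ∈ halfSpace n, 0 < u x)
    (hv : ∀ x ∈ halfSpace n, 0 < v x) (hN : L * (N - 1) = l * (n - 1)) (hN2 : 2 ≤ N)
    (hp1 : 1 < p) (hp : p * (N - 1) = N + 1) : False := by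
  let c : EuclideanSpace ℝ (Fin n) := EuclideanSpace.single i 1
  have hc : 0 < c i := by simp [c]
  have hL : 0 < L := by linarith
  have hN0 : 0 < N := by linarith
  have hpp : 1 < p * p := by nlinarith
  obtain ⟨η, hη, hle⟩ := h.exists_log_le hi hl hlL hu hv hc hN hN2 hp
  refine h.false_of_lower_bound (N := N) (c := c) hi hl hlL (by linarith) (by linarith) hu hv
    hc.le hpp
    (η := η * (3 * 5 ^ (-N) * (3 * l / (L * N)))) (g := fun r => Real.log r) (by positivity)
    ((eventually_gt_atTop 1).mono fun r hr => Real.log_pos hr)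
    (fun r x hr h1 h2 h3 => (le_trans ?_ (hle x (by linarith) (by linarith)))) ?_
  · have hr0 : 0 < r := by linarith
    have ht : 0 ≤ x i - c i := by linarith
    rw [mul_assoc η]
    gcongr
    refine le_trans ?_ (le_add_of_nonneg_right (by positivity))
    rw [sq_rpow (norm_nonneg _), show 2 * -(N / 2) = -N by ring]
    have hlog : Real.log r ≤ Real.log (‖x - c‖ ^ 2) :=
      Real.log_le_log hr0 (by nlinarith)
    have hlog0 := Real.log_nonneg hr
    calc _ = 3 * r * (3 * l / (L * N) * (5 * r) ^ (-N) * Real.log r) := by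
          rw [Real.mul_rpow (by norm_num) hr0.le, sub_eq_add_neg, Real.rpow_add hr0, Real.rpow_one]
          ring
      _ ≤ _ := by
          have := Real.rpow_le_rpow_of_nonpos (z := -N) (by linarith) h3 (by linarith)
          gcongr
  -- At the critical exponent the power of `r` disappears, and only `(log r)^(p² - 1)` drives the
  -- divergence.
  · have he : 2 * (p + 1) - (N - 1) * (p * p - 1) = 0 := by
      linear_combination (-(p + 1)) * hp
    simp only [he, Real.rpow_zero, one_mul]
    exact (tendsto_rpow_atTop (sub_pos.2 hpp)).comp Real.tendsto_log_atTop

theorem false_of_mul_eq_one (h : IsNonnegSystemSupersolution n l L p q u v)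
    (hi : (i : ℕ) + 1 = n)
    (hl : 0 < l) (hlL : l ≤ L) (hp : 0 < p) (hq : 0 < q) (hu : ∀ x ∈ halfSpace n, 0 < u x)
    (hv : ∀ x ∈ halfSpace n, 0 < v x) (hpq : p * q = 1) : False := by
  obtain ⟨κ, hκ, hle⟩ := h.exists_rpow_le i.pos hl hlL hp hq hu hv
  -- This radius gives `κ r² = 2`, and the upper bound then reads `2^(1+p) ≤ 1`.
  have hr : 0 < √(2 / κ) := by positivity
  obtain ⟨x, -, hx⟩ := hle (EuclideanSpace.single i (3 * √(2 / κ))) _ hr fun y hy => by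
    have h1 : |y i - 3 * √(2 / κ)| ≤ 2 * √(2 / κ) := by
      refine le_trans ?_ hy
      simpa [dist_eq_norm] using
        PiLp.norm_apply_le (y - EuclideanSpace.single i (3 * √(2 / κ))) i
    have h2 := (abs_le.1 h1).1
    rw [mem_halfSpace hi]
    linarith
  rw [hpq, sub_self, Real.rpow_zero, mul_one, Real.sq_sqrt (by positivity),
    mul_div_cancel₀ _ hκ.ne'] at hx
  exact hx.not_gt (Real.one_lt_rpow (by norm_num) (by linarith))

end IsNonnegSystemSupersolution

/-! ### Assembly of the cases -/

theorem mainTheorem5 (n : ℕ) (hn : 2 ≤ n) (l L p q : ℝ) (hl : 0 < l) (hlL : l ≤ L)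
    (hp : 0 < p) (hq : 0 < q) (hdim : 2 ≤ dimTilde n l L)
    (hcase :
      (1 < p * q ∧ (dimTilde n l L - 1 < 2 * (p + 1) / (p * q - 1) ∨
        dimTilde n l L - 1 < 2 * (q + 1) / (p * q - 1))) ∨
      (2 * (p + 1) / (p * q - 1) = dimTilde n l L - 1 ∧
        2 * (q + 1) / (p * q - 1) = dimTilde n l L - 1) ∨
      p * q = 1) :
    ¬ ∃ u v : EuclideanSpace ℝ (Fin n) → ℝ,
      IsNonnegSystemSupersolution n l L p q u v ∧
        ∃ x ∈ halfSpace n, u x ≠ 0 ∨ v x ≠ 0 := by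
  rintro ⟨u, v, h, x, hx, hne⟩
  have hn0 : 0 < n := by omega
  obtain ⟨hu, hv⟩ : (∀ x ∈ halfSpace n, 0 < u x) ∧ ∀ x ∈ halfSpace n, 0 < v x := by
    rcases hne with hne | hne
    · have hu := h.pos_left hn0 hl hlL ⟨x, hx, hne⟩
      exact ⟨hu, h.symm.pos_of_pos_right hn0 hlL hu⟩
    · have hv := h.symm.pos_left hn0 hl hlL ⟨x, hx, hne⟩
      exact ⟨h.pos_of_pos_right hn0 hlL hv, hv⟩
  obtain ⟨i, hi⟩ : ∃ i : Fin n, (i : ℕ) + 1 = n := ⟨⟨n - 1, by omega⟩, Nat.sub_add_cancel hn0⟩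
  have hN : L * (dimTilde n l L - 1) = l * (n - 1) := by
    have : L ≠ 0 := by linarith
    rw [dimTilde]
    field_simp
    ring
  generalize dimTilde n l L = N at *
  rcases hcase with ⟨hpq, hsub | hsub⟩ | ⟨h1, h2⟩ | hpq
  · exact h.false_of_subcritical hi hl hlL hp hq hu hv hN (by linarith) hpq hsub
  · rw [mul_comm p q] at hpq hsub
    exact h.symm.false_of_subcritical hi hl hlL hq hp hv hu hN (by linarith) hpq hsub
  -- The equalities force `pq > 1`: otherwise the quotient would be nonpositive (zero if `pq = 1`,
  -- by the convention for division by zero), whereas `N - 1 ≥ 1`. Equal quotients then give `p =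
  -- q`.
  · have hpos : 0 < p * q - 1 := by
      by_contra hneg
      have := div_nonpos_of_nonneg_of_nonpos (by positivity : 0 ≤ 2 * (p + 1)) (not_lt.1 hneg)
      linarith
    rw [div_eq_iff hpos.ne'] at h1 h2
    obtain rfl : p = q := by linarith
    have hp1 : 1 < p := by nlinarith
    refine h.false_of_critical hi hl hlL hu hv hN hdim hp1 ?_
    have : (p + 1) * (p * (N - 1)) = (p + 1) * (N + 1) := by linear_combination -h1
    exact mul_left_cancel₀ (by linarith) this
  · exact h.false_of_mul_eq_one hi hl hlL hp hq hu hv hpq
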